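/- **Conventions.** A *circulation* on a topological space $X$ assigns to each open $U\subset X$ a preorder $\leqslant_U$ on $U$ such that, for every collection $\mathcal O$ of open sets, the preorder on $\bigcup\mathcal O$ is the smallest one whose graph contains the graphs of all $\leqslant_U$, $U\in\mathcal O$. A *stream* is a space with a circulation. A *stream map* is a continuous function $f:X\to Y$ with $f(x)\leqslant_U f(y)$ whenever $x\leqslant_{f^{-1}U}y$ and $U\subset Y$ is open. $\mathbf{DiTop}$ is the category of weak Hausdorff k-streams (colimits, in the category of streams, of compact Hausdorff streams) and stream maps. $\vec{\mathbb I}^n$ is the unit cube with the unique circulation whose preorder on the whole cube is the product order. $\square$ is the category of the lattices $[1]^n$, $n\geqslant 0$, with the functions generated by cofaces, codegeneracies and coordinate permutations. Each $\square$-morphism $\phi:[1]^m\to[1]^n$ induces its multilinear extension $|\phi|:\vec{\mathbb I}^m\to\vec{\mathbb I}^n$. *Cubical sets* are presheaves of sets on $\square$, *cubical functions* are their natural transformations, and $\square[1]^n$ denotes a representable. For a stream $X$, the *directed singular cubical set* $\mathrm{sing}\,X$ has as $n$-cubes the stream maps $\vec{\mathbb I}^n\to X$, with $\square$ acting by precomposition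 with the maps $|\phi|$. * $(-)^\sharp:\hat\square\to\hat\square$ is the left Kan extension of $[1]^n\mapsto\mathrm{sing}\,\vec{\mathbb I}^n$ along the Yoneda embedding, and $\eta_C:C\to C^\sharp$ is the natural map given on representables by $\square[1]^n\to\mathrm{sing}\,\vec{\mathbb I}^n$, $\phi\mapsto|\phi|$. * Identify $([1]^n)^{[1]}$, the lattice of monotone functions $[1]\to[1]^n$, with $\{0,1,2\}^n$ by $\zeta\mapsto\zeta(0)+\zeta(1)$. Let $\mathrm{sd}_2\square[1]^n$ be the cubical set whose $j$-cubes are the lattice homomorphisms $[1]^j\to\{0,1,2\}^n$ that map Boolean intervals onto Boolean intervals. $\mathrm{ex}_2C$ is the cubical set whose $n$-cubes are the cubical functions $\mathrm{sd}_2\square[1]^n\to C$. * $\varphi^\sharp_{C;2}:C^\sharp\to\mathrm{ex}_2(C^\sharp)$ is the natural cubical function that, for $C=\square[1]^m$, sends a stream map $f:\vec{\mathbb I}^n\to\vec{\mathbb I}^m$ to the cubical function $\mathrm{sd}_2\square[1]^n\to\mathrm{sing}\,\vec{\mathbb I}^m$, $\gamma\mapsto f\circ\bar\gamma$, where $\bar\gamma:\vec{\mathbb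 I}^j\to\vec{\mathbb I}^n$ is the affine map sending each vertex $w\in[1]^j$ to $\gamma(w)/2$. Let $G$ be a small category. A *$G$-stream* is a functor $G\to\mathbf{DiTop}$, a *$G$-cubical set* is a functor $G\to\hat\square$, a *$G$-cubical function* is a natural transformation of such functors, and $\mathrm{sing}$, $(-)^\sharp$, $\mathrm{ex}_2$ are applied objectwise. A *$G$-cubcat* is a $G$-cubical set $C$ for which there exist $G$-cubical functions $\rho:C^\sharp\to C$ and $\mu:\mathrm{ex}_2C\to C$ such that $$\rho\circ\eta_C=1_C\qquad\text{and}\qquad \mu\circ(\mathrm{ex}_2\rho)\circ\varphi^\sharp_{C;2}=\rho .$$ **Proposition.** For each small category $G$ and each $G$-stream $X$, the $G$-cubical set $\mathrm{sing}\,X$ is a $G$-cubcat. -/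

import Mathlib

open CategoryTheory

universe u v w

namespace DirectedCubes

/-! ### Finite Boolean lattices and the cube category -/

/-- A subset of a poset is a Boolean interval if it is an interval `[a, b]`, `a ≤ b`, which as a
poset is isomorphic to a power set. -/
def IsBooleanInterval {L : Type} [PartialOrder L] (s : Set L) : Prop :=
  ∃ a b : L, a ≤ b ∧ s = Set.Icc a b ∧ ∃ α : Type, Nonempty (s ≃o Set α)

/-- Lattice homomorphisms mapping Boolean intervals onto Boolean intervals. -/
structure IsDisMap {L M : Type} [Lattice L] [Lattice M] (f : L → M) : Prop where
  map_sup : ∀ x y, f (x ⊔ y) = f x ⊔ f y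
  map_inf : ∀ x y, f (x ⊓ y) = f x ⊓ f y
  map_boolean : ∀ s : Set L, IsBooleanInterval s → IsBooleanInterval (f '' s)

theorem IsDisMap.comp {L M N : Type} [Lattice L] [Lattice M] [Lattice N] {g : M → N} {f : L → M}
    (hg : IsDisMap g) (hf : IsDisMap f) : IsDisMap (g ∘ f) where
  map_sup x y := by simp [hf.map_sup, hg.map_sup]
  map_inf x y := by simp [hf.map_inf, hg.map_inf]
  map_boolean s hs := by
    rw [Set.image_comp]
    exact hg.map_boolean _ (hf.map_boolean _ hs)

theorem IsDisMap.monotone {L M : Type} [Lattice L] [Lattice M] {f : L → M}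
    (hf : IsDisMap f) : Monotone f := by
  intro x y h
  have := hf.map_sup x y
  rw [sup_eq_right.2 h] at this
  rw [this]
  exact le_sup_left

/-- The finite Boolean lattice `[1]ⁿ`. -/
abbrev BoolCube (n : ℕ) : Type := Fin n → Fin 2

/-- The finite distributive lattice `([1]ⁿ)^[k]` of monotone functions `[k] → [1]ⁿ`
(isomorphic to `[k+1]ⁿ`), which is the `(k+1)`-fold subdivision of `[1]ⁿ`. -/
abbrev SdCube (k n : ℕ) : Type := Fin (k + 1) →o BoolCube n

/-- The functions `[1]ᵐ → [1]ⁿ` generated under composition by the cofaces, the codegeneracies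
and the coordinate permutations. -/
inductive IsBoxMap : ∀ {m n : ℕ}, (BoolCube m → BoolCube n) → Prop
  | perm {n : ℕ} (e : Equiv.Perm (Fin n)) : IsBoxMap (fun x : BoolCube n => fun i => x (e i))
  | coface {n : ℕ} (i : Fin (n + 1)) (ε : Fin 2) :
      IsBoxMap (fun x : BoolCube n => (i.insertNth ε x : BoolCube (n + 1)))
  | codegeneracy {n : ℕ} (i : Fin (n + 1)) :
      IsBoxMap (fun x : BoolCube (n + 1) => (i.removeNth x : BoolCube n))
  | comp {l m n : ℕ} {g : BoolCube m → BoolCube n} {f : BoolCube l → BoolCube m} :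
      IsBoxMap g → IsBoxMap f → IsBoxMap (g ∘ f)

theorem IsBoxMap.id (n : ℕ) : IsBoxMap (id : BoolCube n → BoolCube n) :=
  IsBoxMap.perm (Equiv.refl _)

theorem IsBoxMap.coord {m n : ℕ} {f : BoolCube m → BoolCube n} (hf : IsBoxMap f) :
    ∀ i, (∃ c, ∀ x, f x i = c) ∨ ∃ j, ∀ x, f x i = x j := by
  induction hf with
  | perm e => exact fun i => Or.inr ⟨e i, fun _ => rfl⟩
  | coface i ε =>
    intro j
    refine Fin.succAboveCases i ?_ (fun j => ?_) j
    · exact Or.inl ⟨ε, fun x => by simp⟩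
    · exact Or.inr ⟨j, fun x => by simp⟩
  | codegeneracy i => exact fun j => Or.inr ⟨i.succAbove j, fun _ => rfl⟩
  | comp _ _ ihg ihf =>
    intro i
    rcases ihg i with ⟨c, hc⟩ | ⟨j, hj⟩
    · exact Or.inl ⟨c, fun x => hc _⟩
    · rcases ihf j with ⟨c, hc⟩ | ⟨l, hl⟩
      · exact Or.inl ⟨c, fun x => by simp [hj, hc]⟩
      · exact Or.inr ⟨l, fun x => by simp [hj, hl]⟩

theorem IsBoxMap.monotone {m n : ℕ} {f : BoolCube m → BoolCube n} (hf : IsBoxMap f) :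
    Monotone f := by
  intro x y h i
  rcases hf.coord i with ⟨c, hc⟩ | ⟨j, hj⟩
  · rw [hc, hc]
  · rw [hj, hj]; exact h j

theorem IsBoxMap.map_sup {m n : ℕ} {f : BoolCube m → BoolCube n} (hf : IsBoxMap f)
    (x y : BoolCube m) : f (x ⊔ y) = f x ⊔ f y := by
  funext i
  rcases hf.coord i with ⟨c, hc⟩ | ⟨j, hj⟩
  · simp [hc]
  · simp [hj]

theorem IsBoxMap.map_inf {m n : ℕ} {f : BoolCube m → BoolCube n} (hf : IsBoxMap f)
    (x y : BoolCube m) : f (x ⊓ y) = f x ⊓ f y := by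
  funext i
  rcases hf.coord i with ⟨c, hc⟩ | ⟨j, hj⟩
  · simp [hc]
  · simp [hj]

/-- The function `([1]ᵐ)^[k] → ([1]ⁿ)^[k]` of composition with a box map `[1]ᵐ → [1]ⁿ`. -/
def sdMap (k : ℕ) {m n : ℕ} {f : BoolCube m → BoolCube n} (hf : IsBoxMap f) :
    SdCube k m → SdCube k n :=
  fun ζ => ⟨fun t => f (ζ t), fun _ _ h => hf.monotone (ζ.monotone h)⟩

/-- A finite distributive interval is Boolean as soon as it is complemented. -/
theorem isBooleanInterval_of_compl {M : Type} [Lattice M] [Finite M]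
    (dist : ∀ x y z : M, x ⊓ (y ⊔ z) ≤ (x ⊓ y) ⊔ (x ⊓ z)) {c d : M} (h : c ≤ d)
    (hc : ∀ x ∈ Set.Icc c d, ∃ y ∈ Set.Icc c d, x ⊓ y = c ∧ x ⊔ y = d) :
    IsBooleanInterval (Set.Icc c d) := by
  refine ⟨c, d, h, rfl, ?_⟩
  let _ : DistribLattice M := DistribLattice.ofInfSupLe dist
  let _ : BoundedOrder (Set.Icc c d) :=
    { top := ⟨d, h, le_rfl⟩, bot := ⟨c, le_rfl, h⟩, le_top := fun x => x.2.2
      bot_le := fun x => x.2.1 }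
  let _ : DistribLattice (Set.Icc c d) :=
    { (inferInstance : PartialOrder (Set.Icc c d)) with
      sup := fun x y => ⟨x.1 ⊔ y.1, x.2.1.trans le_sup_left, sup_le x.2.2 y.2.2⟩
      inf := fun x y => ⟨x.1 ⊓ y.1, le_inf x.2.1 y.2.1, inf_le_left.trans x.2.2⟩
      le_sup_left := fun x y => le_sup_left (a := x.1) (b := y.1)
      le_sup_right := fun x y => le_sup_right (a := x.1) (b := y.1)
      sup_le := fun x y z h1 h2 => sup_le (a := x.1) (b := y.1) (c := z.1) h1 h2
      inf_le_left := fun x y => inf_le_left (a := x.1) (b := y.1)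
      inf_le_right := fun x y => inf_le_right (a := x.1) (b := y.1)
      le_inf := fun x y z h1 h2 => Subtype.coe_le_coe.1 (le_inf (Subtype.coe_le_coe.2 h1)
        (Subtype.coe_le_coe.2 h2))
      le_sup_inf := fun x y z => le_sup_inf (x := x.1) (y := y.1) (z := z.1) }
  have : ComplementedLattice (Set.Icc c d) := ⟨fun x => by
    obtain ⟨y, hy, h1, h2⟩ := hc x x.2
    refine ⟨⟨y, hy⟩, ?_⟩
    rw [isCompl_iff, disjoint_iff, codisjoint_iff]
    exact ⟨Subtype.ext h1, Subtype.ext h2⟩⟩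
  let _ : BooleanAlgebra (Set.Icc c d) := DistribLattice.booleanAlgebraOfComplemented _
  let _ : Fintype (Set.Icc c d) := Fintype.ofFinite _
  let _ : CompleteAtomicBooleanAlgebra (Set.Icc c d) := Fintype.toCompleteAtomicBooleanAlgebra _
  exact ⟨_, ⟨CompleteAtomicBooleanAlgebra.toSetOfIsAtom⟩⟩

theorem IsBooleanInterval.compl {L : Type} [Lattice L] {a b : L}
    (h : IsBooleanInterval (Set.Icc a b)) (hab : a ≤ b) {x : L} (hx : x ∈ Set.Icc a b) :
    ∃ y ∈ Set.Icc a b, x ⊓ y = a ∧ x ⊔ y = b := by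
  obtain ⟨_, _, _, _, α, ⟨e⟩⟩ := h
  let y : Set.Icc a b := e.symm ((e ⟨x, hx⟩)ᶜ)
  have hey : e y = (e ⟨x, hx⟩)ᶜ := e.apply_symm_apply _
  refine ⟨y, y.2, le_antisymm ?_ (le_inf hx.1 y.2.1), le_antisymm (sup_le hx.2 y.2.2) ?_⟩
  · have hm : x ⊓ y ∈ Set.Icc a b := ⟨le_inf hx.1 y.2.1, inf_le_left.trans hx.2⟩
    have h1 : e ⟨x ⊓ y, hm⟩ ≤ e ⟨x, hx⟩ := e.monotone (Subtype.mk_le_mk.2 inf_le_left)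
    have h2 : e ⟨x ⊓ y, hm⟩ ≤ e y := e.monotone (Subtype.mk_le_mk.2 inf_le_right)
    rw [hey] at h2
    have h3 : e ⟨x ⊓ y, hm⟩ ≤ e ⟨a, le_rfl, hab⟩ := by
      intro p hp
      exact absurd (h1 hp) (h2 hp)
    exact e.le_iff_le.1 h3
  · have hm : x ⊔ y ∈ Set.Icc a b := ⟨hx.1.trans le_sup_left, sup_le hx.2 y.2.2⟩
    have h1 : e ⟨x, hx⟩ ≤ e ⟨x ⊔ y, hm⟩ := e.monotone (Subtype.mk_le_mk.2 le_sup_left)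
    have h2 : e y ≤ e ⟨x ⊔ y, hm⟩ := e.monotone (Subtype.mk_le_mk.2 le_sup_right)
    rw [hey] at h2
    have h3 : e ⟨b, hab, le_rfl⟩ ≤ e ⟨x ⊔ y, hm⟩ := by
      intro p _
      by_cases hp : p ∈ e ⟨x, hx⟩
      · exact h1 hp
      · exact h2 hp
    exact e.le_iff_le.1 h3

/-- A lattice homomorphism that maps intervals onto intervals also preserves Boolean intervals. -/
theorem isDisMap_of_lift {L M : Type} [Lattice L] [Lattice M] [Finite M] {f : L → M}
    (dist : ∀ x y z : M, x ⊓ (y ⊔ z) ≤ (x ⊓ y) ⊔ (x ⊓ z))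
    (hs : ∀ x y, f (x ⊔ y) = f x ⊔ f y) (hi : ∀ x y, f (x ⊓ y) = f x ⊓ f y)
    (lift : ∀ a b, a ≤ b → ∀ z, f a ≤ z → z ≤ f b → ∃ y, a ≤ y ∧ y ≤ b ∧ f y = z) :
    IsDisMap f := by
  have mono : Monotone f := by
    intro x y h
    have := hs x y
    rw [sup_eq_right.2 h] at this
    rw [this]
    exact le_sup_left
  refine ⟨hs, hi, fun s hB => ?_⟩
  obtain ⟨a, b, hab, rfl, -⟩ := id hB
  have himg : f '' Set.Icc a b = Set.Icc (f a) (f b) := by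
    ext z
    constructor
    · rintro ⟨y, hy, rfl⟩
      exact ⟨mono hy.1, mono hy.2⟩
    · rintro ⟨h1, h2⟩
      obtain ⟨y, h3, h4, h5⟩ := lift a b hab z h1 h2
      exact ⟨y, ⟨h3, h4⟩, h5⟩
  rw [himg]
  refine isBooleanInterval_of_compl dist (mono hab) fun z hz => ?_
  obtain ⟨y, h3, h4, rfl⟩ := lift a b hab z hz.1 hz.2
  obtain ⟨y', hy', h5, h6⟩ := hB.compl hab ⟨h3, h4⟩
  exact ⟨f y', ⟨mono hy'.1, mono hy'.2⟩, by rw [← hi, h5], by rw [← hs, h6]⟩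

/-- Box maps lift intervals, by a selection that is monotone. -/
theorem IsBoxMap.exists_section {m n : ℕ} {f : BoolCube m → BoolCube n} (hf : IsBoxMap f) :
    ∃ s : BoolCube m → BoolCube n → BoolCube m,
      (∀ a a' z z', a ≤ a' → z ≤ z' → s a z ≤ s a' z') ∧
      ∀ a b z, a ≤ b → f a ≤ z → z ≤ f b → a ≤ s a z ∧ s a z ≤ b ∧ f (s a z) = z := by
  induction hf with
  | perm e =>
    refine ⟨fun _ z i => z (e.symm i), fun _ _ _ _ _ h i => h _, fun a b z _ h1 h2 =>
      ⟨fun i => ?_, fun i => ?_, ?_⟩⟩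
    · simpa using h1 (e.symm i)
    · simpa using h2 (e.symm i)
    · funext i; simp
  | coface i ε =>
    refine ⟨fun _ z => i.removeNth z, fun _ _ _ _ _ h j => h _, fun a b z _ h1 h2 =>
      ⟨fun j => ?_, fun j => ?_, ?_⟩⟩
    · simpa [Fin.removeNth] using h1 (i.succAbove j)
    · simpa [Fin.removeNth] using h2 (i.succAbove j)
    · have : z i = ε := le_antisymm (by simpa using h2 i) (by simpa using h1 i)
      rw [← this]; exact Fin.insertNth_self_removeNth i z
  | codegeneracy i =>
    refine ⟨fun a z => i.insertNth (a i) z, fun a a' z z' ha hz j => ?_, fun a b z hab h1 h2 =>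
      ⟨fun j => ?_, fun j => ?_, by simp⟩⟩
    · refine Fin.succAboveCases i ?_ (fun j => ?_) j
      · simpa using ha i
      · simpa using hz j
    · refine Fin.succAboveCases i ?_ (fun j => ?_) j
      · simp
      · beta_reduce; rw [Fin.insertNth_apply_succAbove]; exact h1 j
    · refine Fin.succAboveCases i ?_ (fun j => ?_) j
      · simpa using hab i
      · beta_reduce; rw [Fin.insertNth_apply_succAbove]; exact h2 j
  | @comp _ _ _ g f hg hf ihg ihf =>
    obtain ⟨s, hs, hs'⟩ := ihg
    obtain ⟨r, hr, hr'⟩ := ihf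
    refine ⟨fun a z => r a (s (f a) z),
      fun a a' z z' ha hz => hr _ _ _ _ ha (hs _ _ _ _ (hf.monotone ha) hz),
      fun a b z hab h1 h2 => ?_⟩
    obtain ⟨h3, h4, h5⟩ := hs' (f a) (f b) z (hf.monotone hab) h1 h2
    obtain ⟨h6, h7, h8⟩ := hr' a b _ hab h3 h4
    exact ⟨h6, h7, by rw [Function.comp_apply, h8, h5]⟩

theorem IsBoxMap.isDisMap {m n : ℕ} {f : BoolCube m → BoolCube n} (hf : IsBoxMap f) :
    IsDisMap f := by
  obtain ⟨s, -, h⟩ := hf.exists_section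
  exact isDisMap_of_lift (fun x y z => le_of_eq (inf_sup_left x y z)) hf.map_sup hf.map_inf
    fun a b hab z h1 h2 => ⟨s a z, h a b z hab h1 h2⟩

theorem isDisMap_sdMap (k : ℕ) {m n : ℕ} {f : BoolCube m → BoolCube n} (hf : IsBoxMap f) :
    IsDisMap (sdMap k hf) := by
  have : Finite (SdCube k n) := DFunLike.finite _
  obtain ⟨s, hs, h⟩ := hf.exists_section
  refine isDisMap_of_lift (fun x y z t => le_of_eq (inf_sup_left (x t) (y t) (z t)))
    (fun x y => OrderHom.ext _ _ (funext fun t => hf.map_sup _ _))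
    (fun x y => OrderHom.ext _ _ (funext fun t => hf.map_inf _ _))
    fun a b hab z h1 h2 => ⟨⟨fun t => s (a t) (z t), fun t t' ht =>
      hs _ _ _ _ (a.monotone ht) (z.monotone ht)⟩, fun t => (h _ _ _ (hab t) (h1 t) (h2 t)).1,
      fun t => (h _ _ _ (hab t) (h1 t) (h2 t)).2.1,
      OrderHom.ext _ _ (funext fun t => (h _ _ _ (hab t) (h1 t) (h2 t)).2.2)⟩

/-! ### Streams -/

open TopologicalSpace

/-- A circulation on a topological space: a preorder `le U` on each open subset `U` such that the
preorder on a union of open sets is the smallest one containing the preorders on these sets. -/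
structure Circulation (X : Type u) [TopologicalSpace X] where
  le : Opens X → X → X → Prop
  mem_left : ∀ {U x y}, le U x y → x ∈ U
  mem_right : ∀ {U x y}, le U x y → y ∈ U
  refl : ∀ {U x}, x ∈ U → le U x x
  trans : ∀ {U x y z}, le U x y → le U y z → le U x z
  le_sSup : ∀ (S : Set (Opens X)) (x y : X), le (sSup S) x y ↔
    x ∈ sSup S ∧ Relation.ReflTransGen (fun a b => ∃ U ∈ S, le U a b) x y

/-- Streams: topological spaces with a circulation. -/
structure TopStream : Type (u + 1) where
  carrier : Type u
  [top : TopologicalSpace carrier]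
  circ : Circulation carrier

attribute [instance] TopStream.top

instance : CoeSort TopStream.{u} (Type u) := ⟨TopStream.carrier⟩

/-- Stream maps: continuous functions `f` such that `f x ≤_U f y` whenever `x ≤_{f⁻¹U} y`. -/
@[ext]
structure StreamMap (X : TopStream.{u}) (Y : TopStream.{v}) extends C(X, Y) where
  map_le : ∀ (U : Opens Y) (x y : X), X.circ.le (U.comap toContinuousMap) x y →
    Y.circ.le U (toFun x) (toFun y)

namespace StreamMap

instance {X : TopStream.{u}} {Y : TopStream.{v}} : FunLike (StreamMap X Y) X Y where
  coe f := f.toFun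
  coe_injective _ _ h := StreamMap.ext h

theorem hext {X : TopStream.{u}} {Y : TopStream.{v}} {f g : StreamMap X Y}
    (h : ∀ x, f x = g x) : f = g :=
  DFunLike.ext _ _ h

/-- The identity stream map. -/
def id (X : TopStream.{u}) : StreamMap X X where
  toContinuousMap := ContinuousMap.id X
  map_le _ _ _ h := h

/-- Composition of stream maps. -/
def comp {X : TopStream.{u}} {Y : TopStream.{v}} {Z : TopStream.{w}}
    (g : StreamMap Y Z) (f : StreamMap X Y) : StreamMap X Z where
  toContinuousMap := g.toContinuousMap.comp f.toContinuousMap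
  map_le U x y h := g.map_le U _ _ (f.map_le (U.comap g.toContinuousMap) x y h)

@[simp] theorem id_apply (X : TopStream.{u}) (x : X) : id X x = x := rfl

@[simp] theorem comp_apply {X : TopStream.{u}} {Y : TopStream.{v}} {Z : TopStream.{w}}
    (g : StreamMap Y Z) (f : StreamMap X Y) (x : X) : g.comp f x = g (f x) := rfl

end StreamMap

instance : Category TopStream.{u} where
  Hom X Y := StreamMap X Y
  id X := StreamMap.id X
  comp f g := StreamMap.comp g f

/-- A k-stream is a colimit, in the category of streams, of compact Hausdorff streams. -/
def IsKStream (X : TopStream.{u}) : Prop :=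
  ∃ (J : Type u) (_ : SmallCategory J) (F : J ⥤ TopStream.{u}) (c : Limits.Cocone F),
    (∀ j, CompactSpace (F.obj j) ∧ T2Space (F.obj j)) ∧
      Nonempty (Limits.IsColimit c) ∧ Nonempty (c.pt ≅ X)

/-- A topological space is weak Hausdorff if images in it of compact Hausdorff spaces are
Hausdorff. -/
def IsWeakHausdorff (X : Type u) [TopologicalSpace X] : Prop :=
  ∀ (K : Type u) [TopologicalSpace K] [CompactSpace K] [T2Space K] (f : C(K, X)),
    T2Space (Set.range f)

/-- The category of weak Hausdorff k-streams and stream maps. -/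
abbrev DiTop : Type (u + 1) :=
  ObjectProperty.FullSubcategory (fun X : TopStream.{u} => IsKStream X ∧ IsWeakHausdorff X)

/-! ### Directed topological cubes -/

open unitInterval in
/-- The topological cube `𝕀ⁿ`, with the product topology and the product order. -/
abbrev ICube (n : ℕ) : Type := Fin n → I

theorem reflTransGen_mono {X : Type u} {r p : X → X → Prop} (h : ∀ a b, r a b → p a b) {x y : X}
    (hxy : Relation.ReflTransGen r x y) : Relation.ReflTransGen p x y := by
  induction hxy with
  | refl => exact .refl
  | tail _ hbc ih => exact ih.tail (h _ _ hbc)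

theorem exists_chain {n : ℕ} {S : Set (Opens (ICube n))} (γ : unitInterval → ICube n)
    (hc : Continuous γ) (hm : Monotone γ) (hS : ∀ t, ∃ U ∈ S, γ t ∈ U) :
    Relation.ReflTransGen (fun a b => ∃ U ∈ S, a ≤ b ∧ Set.Icc a b ⊆ U) (γ 0) (γ 1) := by
  choose U hU hγ using hS
  have hball : ∀ t, ∃ ε > 0, Metric.ball (γ t) ε ⊆ U t := fun t =>
    Metric.isOpen_iff.1 (U t).isOpen _ (hγ t)
  choose ε hε hsub using hball
  obtain ⟨t, ht0, htm, ⟨N, hN⟩, ht⟩ := exists_monotone_Icc_subset_open_cover_unitInterval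
    (c := fun s => γ ⁻¹' Metric.ball (γ s) (ε s)) (fun s => Metric.isOpen_ball.preimage hc)
    (fun x _ => Set.mem_iUnion.2 ⟨x, Metric.mem_ball_self (hε x)⟩)
  have key : ∀ k, Relation.ReflTransGen (fun a b => ∃ U ∈ S, a ≤ b ∧ Set.Icc a b ⊆ U)
      (γ 0) (γ (t k)) := by
    intro k
    induction k with
    | zero => rw [ht0]
    | succ k ih =>
      refine ih.tail ?_
      obtain ⟨s, hs⟩ := ht k
      have hk := htm (Nat.le_succ k)
      refine ⟨U s, hU s, hm hk, fun z hz => hsub s ?_⟩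
      have h1 := hs (Set.left_mem_Icc.2 hk)
      have h2 := hs (Set.right_mem_Icc.2 hk)
      rw [Set.mem_preimage, Metric.mem_ball, dist_pi_lt_iff (hε s)] at h1 h2
      rw [Metric.mem_ball, dist_pi_lt_iff (hε s)]
      intro i
      have h3 := abs_lt.1 (h1 i)
      have h4 := abs_lt.1 (h2 i)
      have h5 : (γ (t k) i : ℝ) ≤ z i := hz.1 i
      have h6 : (z i : ℝ) ≤ γ (t (k + 1)) i := hz.2 i
      exact abs_lt.2 ⟨by linarith [h3.1], by linarith [h4.2]⟩
  have := key N
  rwa [hN N le_rfl] at this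

/-- The straight monotone path from `a` to `b`. -/
theorem exists_path {n : ℕ} {a b : ICube n} (h : a ≤ b) :
    ∃ γ : unitInterval → ICube n, Continuous γ ∧ Monotone γ ∧ γ 0 = a ∧ γ 1 = b ∧
      ∀ t, γ t ∈ Set.Icc a b := by
  have hab : ∀ i, (a i : ℝ) ≤ b i := fun i => h i
  have hmem : ∀ (t : unitInterval) i, (a i : ℝ) + t * (b i - a i) ∈ Set.Icc (a i : ℝ) (b i) := by
    intro t i
    have h1 := hab i
    have h2 := t.2.1
    have h3 := t.2.2
    constructor <;> nlinarith
  refine ⟨fun t i => ⟨a i + t * (b i - a i), (a i).2.1.trans (hmem t i).1,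
    (hmem t i).2.trans (b i).2.2⟩, ?_, ?_, ?_, ?_, ?_⟩
  · fun_prop
  · intro s t hst i
    have h1 := hab i
    have h2 : (s : ℝ) ≤ t := hst
    refine Subtype.mk_le_mk.2 ?_
    nlinarith
  · funext i; simp
  · funext i; simp
  · exact fun t => ⟨fun i => (hmem t i).1, fun i => (hmem t i).2⟩

/-- The circulation on the cube `𝕀ⁿ`: the preorder on `U` is generated by the pairs `a ≤ b` whose
order interval lies in `U`. -/
def cubeCirculation (n : ℕ) : Circulation (ICube n) where
  le U x y := x ∈ U ∧ Relation.ReflTransGen (fun a b => a ≤ b ∧ Set.Icc a b ⊆ U) x y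
  mem_left h := h.1
  mem_right := by
    rintro U x y ⟨hx, h⟩
    induction h with
    | refl => exact hx
    | tail _ hbc _ => exact hbc.2 (Set.right_mem_Icc.2 hbc.1)
  refl h := ⟨h, .refl⟩
  trans h h' := ⟨h.1, h.2.trans h'.2⟩
  le_sSup S x y := by
    refine and_congr_right fun hx => ⟨fun h => ?_, fun h => ?_⟩
    · induction h with
      | refl => exact .refl
      | @tail b c _ hbc ih =>
        refine ih.trans ?_
        obtain ⟨γ, h1, h2, rfl, rfl, h5⟩ := exists_path hbc.1
        refine reflTransGen_mono ?_ (exists_chain (S := S) γ h1 h2 fun t => ?_)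
        · rintro a b ⟨U, hU, hab, hs⟩
          exact ⟨U, hU, hs (Set.left_mem_Icc.2 hab), .single ⟨hab, hs⟩⟩
        · simpa using hbc.2 (h5 t)
    · induction h with
      | refl => exact .refl
      | tail _ hbc ih =>
        obtain ⟨U, hU, -, h⟩ := hbc
        exact ih.trans (reflTransGen_mono (fun a b hab => ⟨hab.1, fun z hz => Opens.mem_sSup.2 ⟨U, hU, hab.2 hz⟩⟩) h)

/-- The preorder on the whole cube is the product order. -/
theorem cubeCirculation_top (n : ℕ) (x y : ICube n) :
    (cubeCirculation n).le ⊤ x y ↔ x ≤ y := by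
  refine ⟨fun h => ?_, fun h => ⟨trivial, .single ⟨h, fun _ _ => trivial⟩⟩⟩
  obtain ⟨-, h⟩ := h
  induction h with
  | refl => exact le_rfl
  | tail _ h ih => exact ih.trans h.1

theorem Circulation.mono {X : Type u} [TopologicalSpace X] (c : Circulation X) {U V : Opens X}
    (h : U ≤ V) {x y : X} (hxy : c.le U x y) : c.le V x y := by
  have := c.le_sSup {U, V} x y
  rw [sSup_pair, sup_eq_right.2 h] at this
  exact this.2 ⟨h (c.mem_left hxy), .single ⟨U, by simp, hxy⟩⟩

theorem Circulation.of_gen {X : Type u} [TopologicalSpace X] (c : Circulation X) {U : Opens X}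
    {r : X → X → Prop} (hr : ∀ a b, r a b → c.le U a b) {x y : X} (hx : x ∈ U)
    (h : Relation.ReflTransGen r x y) : c.le U x y := by
  induction h with
  | refl => exact c.refl hx
  | tail _ h ih => exact c.trans ih (hr _ _ h)

/-- The circulation on the cube is the only one whose preorder on the whole cube is the product
order. -/
theorem cubeCirculation_unique {n : ℕ} (c : Circulation (ICube n))
    (h : ∀ x y, c.le ⊤ x y ↔ x ≤ y) (U : Opens (ICube n)) (x y : ICube n) :
    c.le U x y ↔ (cubeCirculation n).le U x y := by
  have hle : ∀ {V : Opens (ICube n)} {a b}, c.le V a b → a ≤ b := fun hab =>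
    (h _ _).1 (c.mono le_top hab)
  constructor
  · intro hxy
    have hU : sSup {V : Opens (ICube n) | V ≤ U ∧ ∀ a ∈ V, ∀ b ∈ V, Set.Icc a b ⊆ V} = U := by
      refine le_antisymm (sSup_le fun V hV => hV.1) fun p hp => ?_
      obtain ⟨ε, hε, hs⟩ := Metric.isOpen_iff.1 U.isOpen p hp
      refine Opens.mem_sSup.2 ⟨⟨Metric.ball p ε, Metric.isOpen_ball⟩, ⟨hs, ?_⟩,
        Metric.mem_ball_self hε⟩
      intro a ha b hb z hz
      change z ∈ Metric.ball p ε
      change a ∈ Metric.ball p ε at ha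
      change b ∈ Metric.ball p ε at hb
      rw [Metric.mem_ball, dist_pi_lt_iff hε] at ha hb ⊢
      intro i
      have h3 := abs_lt.1 (ha i)
      have h4 := abs_lt.1 (hb i)
      have h5 : (a i : ℝ) ≤ z i := hz.1 i
      have h6 : (z i : ℝ) ≤ b i := hz.2 i
      exact abs_lt.2 ⟨by linarith [h3.1], by linarith [h4.2]⟩
    have h1 := hxy
    rw [← hU, c.le_sSup] at h1
    refine (cubeCirculation n).of_gen ?_ (c.mem_left hxy) h1.2
    rintro a b ⟨V, hV, hab⟩
    exact ⟨hV.1 (c.mem_left hab), .single ⟨hle hab,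
      (hV.2 a (c.mem_left hab) b (c.mem_right hab)).trans hV.1⟩⟩
  · rintro ⟨hx, hxy⟩
    refine c.of_gen ?_ hx hxy
    rintro a b ⟨hab, hs⟩
    have htop : sSup {U, (⟨(Set.Icc a b)ᶜ, isClosed_Icc.isOpen_compl⟩ : Opens (ICube n))} = ⊤ := by
      rw [sSup_pair, eq_top_iff]
      intro p _
      by_cases hp : p ∈ Set.Icc a b
      · exact Or.inl (hs hp)
      · exact Or.inr hp
    have h1 := (h a b).2 hab
    rw [← htop, c.le_sSup] at h1
    have key : ∀ z, Relation.ReflTransGen (fun p q => ∃ V ∈ ({U, (⟨(Set.Icc a b)ᶜ,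
        isClosed_Icc.isOpen_compl⟩ : Opens (ICube n))} : Set (Opens (ICube n))), c.le V p q) a z →
        z ≤ b → a ≤ z ∧ c.le U a z := by
      intro z hz
      induction hz with
      | refl => exact fun _ => ⟨le_rfl, c.refl (hs ⟨le_rfl, hab⟩)⟩
      | @tail p q _ hpq ih =>
        intro hqb
        obtain ⟨V, hV, hpq⟩ := hpq
        have hp := ih ((hle hpq).trans hqb)
        refine ⟨hp.1.trans (hle hpq), c.trans hp.2 ?_⟩
        rcases hV with rfl | rfl
        · exact hpq
        · exact absurd (⟨hp.1, (hle hpq).trans hqb⟩ : p ∈ Set.Icc a b) (c.mem_left hpq)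
    exact (key b h1.2 le_rfl).2

/-- The directed cube `𝕀ⁿ` as a stream. -/
def dicube (n : ℕ) : TopStream.{0} where
  carrier := ICube n
  circ := cubeCirculation n

/-- The directed cubes are weak Hausdorff k-streams. -/
theorem dicube_mem (n : ℕ) : IsKStream (dicube n) ∧ IsWeakHausdorff (dicube n) := by
  constructor
  · refine ⟨Discrete PUnit, inferInstance, (Functor.const _).obj (dicube n),
      ⟨dicube n, 𝟙 _⟩, fun _ => ⟨?_, ?_⟩, ⟨{ desc := fun s => s.ι.app ⟨⟨⟩⟩ }⟩, ⟨Iso.refl _⟩⟩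
    · exact inferInstanceAs (CompactSpace (ICube n))
    · exact inferInstanceAs (T2Space (ICube n))
  · intro K _ _ _ f
    have : T2Space (dicube n) := inferInstanceAs (T2Space (ICube n))
    infer_instance

/-- Continuous monotone functions between cubes are stream maps. -/
def StreamMap.ofMonotone {m n : ℕ} (f : ICube m → ICube n) (hc : Continuous f)
    (hm : Monotone f) : StreamMap (dicube m) (dicube n) where
  toFun := f
  continuous_toFun := hc
  map_le U x y h := by
    refine (cubeCirculation n).trans ((cubeCirculation n).refl h.1) ?_
    obtain ⟨hx, h⟩ := h
    induction h with
    | refl => exact (cubeCirculation n).refl hx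
    | @tail b c _ hbc ih =>
      refine (cubeCirculation n).trans ih ?_
      obtain ⟨γ, h1, h2, rfl, rfl, h5⟩ := exists_path hbc.1
      have hU : ∀ t, f (γ t) ∈ U := fun t => hbc.2 (h5 t)
      refine ⟨hU 0, reflTransGen_mono ?_ (exists_chain (S := {U}) (f ∘ γ) (hc.comp h1)
        (hm.comp h2) fun t => ⟨U, rfl, hU t⟩)⟩
      rintro a b ⟨V, rfl, h⟩
      exact h

/-! ### Multilinear interpolation and directed realizations of cubes -/

/-- The multilinear function on `ℝᵐ` with prescribed values on the vertices of the unit cube. -/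
noncomputable def interp {m : ℕ} (g : BoolCube m → ℝ) (x : Fin m → ℝ) : ℝ :=
  ∑ v : BoolCube m, (∏ j, if v j = 1 then x j else 1 - x j) * g v

theorem interp_rec {m : ℕ} (i : Fin (m + 1)) (g : BoolCube (m + 1) → ℝ) (x : Fin (m + 1) → ℝ) :
    interp g x = (1 - x i) * interp (fun v => g (i.insertNth 0 v)) (i.removeNth x) +
      x i * interp (fun v => g (i.insertNth 1 v)) (i.removeNth x) := by
  unfold interp
  rw [← (Fin.insertNthEquiv (fun _ => Fin 2) i).sum_comp, Fintype.sum_prod_type,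
    Fin.sum_univ_two, Finset.mul_sum, Finset.mul_sum]
  congr 1 <;>
  · refine Finset.sum_congr rfl fun v _ => ?_
    rw [Fin.prod_univ_succAbove _ i]
    simp [Fin.insertNthEquiv, Fin.removeNth, mul_assoc]

theorem interp_const {m : ℕ} (c : ℝ) (x : Fin m → ℝ) : interp (fun _ => c) x = c := by
  induction m with
  | zero => simp [interp]
  | succ m ih => rw [interp_rec 0, ih]; ring

theorem interp_coord {m : ℕ} (j : Fin m) (g : Fin 2 → ℝ) (x : Fin m → ℝ) :
    interp (fun v => g (v j)) x = (1 - x j) * g 0 + x j * g 1 := by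
  cases m with
  | zero => exact j.elim0
  | succ m => rw [interp_rec j]; simp [interp_const]

theorem interp_mono_left {m : ℕ} {g h : BoolCube m → ℝ} (hgh : ∀ v, g v ≤ h v) {x : Fin m → ℝ}
    (hx : ∀ j, x j ∈ Set.Icc (0 : ℝ) 1) : interp g x ≤ interp h x := by
  refine Finset.sum_le_sum fun v _ => mul_le_mul_of_nonneg_left (hgh v) ?_
  refine Finset.prod_nonneg fun j _ => ?_
  have := hx j
  split_ifs
  · exact this.1
  · linarith [this.2]

theorem interp_mono {m : ℕ} {g : BoolCube m → ℝ} (hg : Monotone g) {x y : Fin m → ℝ}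
    (hx : ∀ j, x j ∈ Set.Icc (0 : ℝ) 1) (hy : ∀ j, y j ∈ Set.Icc (0 : ℝ) 1) (hxy : x ≤ y) :
    interp g x ≤ interp g y := by
  induction m with
  | zero => rw [Subsingleton.elim x y]
  | succ m ih =>
    have hins : ∀ ε : Fin 2, Monotone fun v : BoolCube m => g ((0 : Fin (m + 1)).insertNth ε v) :=
      fun ε v w h => hg (Fin.insertNth_le_iff.2 (by simpa using h))
    have h01 : ∀ v : BoolCube m, g ((0 : Fin (m + 1)).insertNth 0 v) ≤
        g ((0 : Fin (m + 1)).insertNth 1 v) :=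
      fun v => hg (Fin.insertNth_le_iff.2 (by simp))
    have hx' : ∀ j, (0 : Fin (m + 1)).removeNth x j ∈ Set.Icc (0 : ℝ) 1 := fun j => hx _
    have hy' : ∀ j, (0 : Fin (m + 1)).removeNth y j ∈ Set.Icc (0 : ℝ) 1 := fun j => hy _
    have hxy' : (0 : Fin (m + 1)).removeNth x ≤ (0 : Fin (m + 1)).removeNth y := fun j => hxy _
    have h0 := ih (hins 0) hx' hy' hxy'
    have h1 := ih (hins 1) hx' hy' hxy'
    have h2 := interp_mono_left h01 hy'
    rw [interp_rec 0 g x, interp_rec 0 g y]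
    have hx0 := hx 0
    have hxy0 := hxy 0
    have h3 := mul_le_mul_of_nonneg_left h0 (sub_nonneg.2 hx0.2)
    have h4 := mul_le_mul_of_nonneg_left h1 hx0.1
    nlinarith

theorem interp_mem {m : ℕ} {g : BoolCube m → ℝ} (hg : ∀ v, g v ∈ Set.Icc (0 : ℝ) 1)
    {x : Fin m → ℝ} (hx : ∀ j, x j ∈ Set.Icc (0 : ℝ) 1) : interp g x ∈ Set.Icc (0 : ℝ) 1 := by
  constructor
  · exact (interp_const 0 x).symm.le.trans (interp_mono_left (fun v => (hg v).1) hx)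
  · exact (interp_mono_left (fun v => (hg v).2) hx).trans (interp_const 1 x).le

/-- The stream map `𝕀ᵐ → 𝕀ⁿ` that interpolates multilinearly a monotone assignment of points of
`𝕀ⁿ` to the vertices of `𝕀ᵐ`. -/
noncomputable def cellMap {m n : ℕ} (g : BoolCube m → ICube n) (hg : Monotone g) :
    StreamMap (dicube m) (dicube n) :=
  StreamMap.ofMonotone
    (fun x i => ⟨interp (fun v => (g v i : ℝ)) (fun j => x j),
      interp_mem (fun v => (g v i).2) (fun j => (x j).2)⟩)
    (by
      unfold interp
      refine continuous_pi fun i => Continuous.subtype_mk ?_ _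
      refine continuous_finsetSum _ fun v _ => Continuous.mul ?_ continuous_const
      refine continuous_finsetProd _ fun j _ => ?_
      split_ifs <;> fun_prop)
    (fun x y h i => interp_mono (fun v w hvw => hg hvw i) (fun j => (x j).2) (fun j => (y j).2) h)

/-- The inclusion of the vertices `[1]ⁿ` into `𝕀ⁿ`. -/
noncomputable def vertex {n : ℕ} (v : BoolCube n) : ICube n :=
  fun i => if v i = 1 then 1 else 0

theorem vertex_mono {n : ℕ} : Monotone (vertex (n := n)) := by
  intro v w h i
  have h0 := h i
  unfold vertex
  split_ifs with h1 h2
  · exact le_rfl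
  · rw [h1] at h0
    exact absurd (le_antisymm (Fin.le_last _) h0) h2
  · exact unitInterval.nonneg'
  · exact le_rfl

/-- The position in `𝕀ⁿ` of a vertex of the `(k+1)`-fold subdivision of the `n`-cube: the element
`ζ` of `([1]ⁿ)^[k]`, identified with `v = ∑ₜ ζ t` in `[k+1]ⁿ`, lies at `v / (k+1)`. -/
noncomputable def sdVertex (k : ℕ) {n : ℕ} (ζ : SdCube k n) : ICube n :=
  fun i => ⟨(∑ t, ((ζ t i : ℕ) : ℝ)) / (k + 1), by
    constructor
    · positivity
    · rw [div_le_one (by positivity)]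
      calc (∑ t, ((ζ t i : ℕ) : ℝ)) ≤ ∑ _t : Fin (k + 1), (1 : ℝ) :=
            Finset.sum_le_sum fun t _ => by
              have : (ζ t i : ℕ) ≤ 1 := by omega
              exact_mod_cast this
        _ = k + 1 := by simp⟩

theorem sdVertex_mono (k : ℕ) {n : ℕ} : Monotone (sdVertex k (n := n)) := by
  intro ζ ξ h i
  refine Subtype.mk_le_mk.2 (div_le_div_of_nonneg_right ?_ (by positivity))
  refine Finset.sum_le_sum fun t _ => ?_
  have : (ζ t i : ℕ) ≤ ξ t i := h t i
  exact_mod_cast this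

/-- The directed realization `𝕀ᵐ → 𝕀ⁿ` of a box map `[1]ᵐ → [1]ⁿ`. -/
noncomputable def realize {m n : ℕ} {f : BoolCube m → BoolCube n} (hf : IsBoxMap f) :
    StreamMap (dicube m) (dicube n) :=
  cellMap (vertex ∘ f) (vertex_mono.comp hf.monotone)

/-- The restriction of the homeomorphism from the directed realization of the `(k+1)`-fold
subdivision of the `n`-cube to `𝕀ⁿ` along a cell `γ : [1]ʲ → ([1]ⁿ)^[k]` of the subdivision: it is
linear on the cell and sends each vertex to its position in `𝕀ⁿ`. -/
noncomputable def sdCell (k : ℕ) {j n : ℕ} {γ : BoolCube j → SdCube k n} (hγ : IsDisMap γ) :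
    StreamMap (dicube j) (dicube n) :=
  cellMap (sdVertex k ∘ γ) ((sdVertex_mono k).comp hγ.monotone)

theorem cellMap_apply {m n : ℕ} (g : BoolCube m → ICube n) (hg : Monotone g) (x : ICube m)
    (i : Fin n) : ((cellMap g hg x : ICube n) i : ℝ) =
      interp (fun v => (g v i : ℝ)) (fun j => x j) := rfl

theorem vertex_coe {n : ℕ} (v : BoolCube n) (i : Fin n) : (vertex v i : ℝ) = ((v i : ℕ) : ℝ) := by
  unfold vertex
  split_ifs with h
  · simp [h]
  · have : v i = 0 := by omega
    simp [this]

theorem interp_comp {m n : ℕ} {f : BoolCube m → BoolCube n} (hf : IsBoxMap f)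
    (g : BoolCube n → ℝ) (x : Fin m → ℝ) :
    interp g (fun i => interp (fun v => (vertex (f v) i : ℝ)) x) = interp (g ∘ f) x := by
  induction hf with
  | @perm n e =>
    have h : ∀ i, interp (fun v : BoolCube n => (vertex (fun i => v (e i)) i : ℝ)) x = x (e i) := by
      intro i
      simp only [vertex_coe]
      rw [interp_coord (e i) (fun c => ((c : ℕ) : ℝ))]
      simp
    simp only [h]
    refine Fintype.sum_equiv (e.arrowCongr (Equiv.refl (Fin 2))) _ _ fun v => ?_
    congr 1
    · exact Fintype.prod_equiv e _ _ fun j => by simp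
    · simp
  | @coface n i ε =>
    have h : (fun j => interp (fun v : BoolCube n =>
        (vertex (i.insertNth ε v : BoolCube (n + 1)) j : ℝ)) x) =
          (i.insertNth ((ε : ℕ) : ℝ) x : Fin (n + 1) → ℝ) := by
      funext j
      simp only [vertex_coe]
      refine Fin.succAboveCases i ?_ (fun j => ?_) j
      · simp [interp_const]
      · simp only [Fin.insertNth_apply_succAbove]
        rw [interp_coord j (fun c => ((c : ℕ) : ℝ))]
        simp
    rw [h, interp_rec i]
    fin_cases ε <;> simp [Function.comp_def]
  | @codegeneracy n i =>
    have h : ∀ j, interp (fun v : BoolCube (n + 1) => (vertex (i.removeNth v) j : ℝ)) x =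
        i.removeNth x j := by
      intro j
      simp only [vertex_coe, Fin.removeNth]
      rw [interp_coord (i.succAbove j) (fun c => ((c : ℕ) : ℝ))]
      simp
    simp only [h]
    rw [interp_rec i (g ∘ _)]
    simp only [Function.comp_def, Fin.removeNth_insertNth]
    ring
  | @comp l m n g' f hg hf ihg ihf =>
    have h : ∀ i, interp (fun v => (vertex ((g' ∘ f) v) i : ℝ)) x =
        interp (fun v => (vertex (g' v) i : ℝ))
          (fun i => interp (fun v => (vertex (f v) i : ℝ)) x) := by
      intro i
      rw [ihf]; rfl
    simp only [h]
    rw [ihg, ihf]; rfl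

theorem cellMap_comp_realize {l m n : ℕ} (g : BoolCube m → ICube n) (hg : Monotone g)
    {f : BoolCube l → BoolCube m} (hf : IsBoxMap f) :
    (cellMap g hg).comp (realize hf) = cellMap (g ∘ f) (hg.comp hf.monotone) := by
  refine StreamMap.hext fun x => ?_
  refine funext fun i => Subtype.ext ?_
  exact interp_comp hf (fun v => (g v i : ℝ)) (fun j => x j)

theorem realize_id (n : ℕ) : realize (IsBoxMap.id n) = StreamMap.id (dicube n) := by
  refine StreamMap.hext fun x => ?_
  refine funext fun i => Subtype.ext ?_
  refine (interp_coord i (fun c => ((if c = 1 then 1 else 0 : unitInterval) : ℝ)) _).trans ?_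
  simp

theorem realize_comp {l m n : ℕ} {g : BoolCube m → BoolCube n} (hg : IsBoxMap g)
    {f : BoolCube l → BoolCube m} (hf : IsBoxMap f) :
    realize (hg.comp hf) = (realize hg).comp (realize hf) :=
  (cellMap_comp_realize (vertex ∘ g) (vertex_mono.comp hg.monotone) hf).symm

theorem sdCell_comp (k : ℕ) {l j n : ℕ} {γ : BoolCube j → SdCube k n} (hγ : IsDisMap γ)
    {f : BoolCube l → BoolCube j} (hf : IsBoxMap f) :
    sdCell k (hγ.comp hf.isDisMap) = (sdCell k hγ).comp (realize hf) :=
  (cellMap_comp_realize (sdVertex k ∘ γ) ((sdVertex_mono k).comp hγ.monotone) hf).symm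

theorem realize_comp_sdCell (k : ℕ) {j m n : ℕ} {f : BoolCube m → BoolCube n} (hf : IsBoxMap f)
    {γ : BoolCube j → SdCube k m} (hγ : IsDisMap γ) :
    (realize hf).comp (sdCell k hγ) = sdCell k ((isDisMap_sdMap k hf).comp hγ) := by
  refine StreamMap.hext fun x => ?_
  refine funext fun i => Subtype.ext ?_
  change interp (fun v => (vertex (f v) i : ℝ)) (fun j => interp _ _) =
    interp (fun v => (sdVertex k (sdMap k hf (γ v)) i : ℝ)) _
  simp only [vertex_coe]
  rcases hf.coord i with ⟨c, hc⟩ | ⟨p, hp⟩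
  · have : ∀ v, (sdVertex k (sdMap k hf (γ v)) i : ℝ) = ((c : ℕ) : ℝ) := by
      intro v
      have h1 : ∀ t, sdMap k hf (γ v) t i = c := fun t => hc _
      simp only [sdVertex, h1]
      have : (k : ℝ) + 1 ≠ 0 := by positivity
      simp [this]
    simp only [this, hc, interp_const]
  · have : ∀ v, (sdVertex k (sdMap k hf (γ v)) i : ℝ) = sdVertex k (γ v) p := by
      intro v
      have h1 : ∀ t, sdMap k hf (γ v) t i = γ v t p := fun t => hp _
      simp only [sdVertex, h1]
    simp only [this, hp]
    rw [interp_coord p (fun c => ((c : ℕ) : ℝ))]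
    simp

/-! ### Cubical sets -/

/-- The objects `[1]ⁿ` of the cube category. -/
structure Box : Type where
  dim : ℕ

/-- The cube category: the morphisms `[1]ᵐ → [1]ⁿ` are the functions generated by the cofaces,
the codegeneracies and the coordinate permutations. -/
instance : SmallCategory Box where
  Hom m n := {f : BoolCube m.dim → BoolCube n.dim // IsBoxMap f}
  id n := ⟨id, IsBoxMap.id n.dim⟩
  comp f g := ⟨g.1 ∘ f.1, g.2.comp f.2⟩

/-- Cubical sets: presheaves on the cube category. -/
abbrev CubicalSet : Type (u + 1) := Boxᵒᵖ ⥤ Type u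

/-- The cubical set `□[sd_{k+1} [1]ⁿ]`, covariant in `[1]ⁿ`: its `j`-cubes are the lattice
homomorphisms `[1]ʲ → ([1]ⁿ)^[k]` preserving Boolean intervals. -/
def sdBox (k : ℕ) : Box ⥤ CubicalSet.{u} where
  obj n :=
    { obj := fun j => ULift {γ : BoolCube j.unop.dim → SdCube k n.dim // IsDisMap γ}
      map := fun f => ↾fun γ => ⟨⟨γ.down.1 ∘ f.unop.1, γ.down.2.comp f.unop.2.isDisMap⟩⟩ }
  map f :=
    { app := fun j => ↾fun γ => ⟨⟨sdMap k f.2 ∘ γ.down.1, (isDisMap_sdMap k f.2).comp γ.down.2⟩⟩ }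

/-- The functor `ex_{k+1}` on cubical sets: the `n`-cubes of `ex_{k+1} C` are the cubical functions
`□[sd_{k+1} [1]ⁿ] → C`. -/
def ex (k : ℕ) : CubicalSet.{u} ⥤ CubicalSet.{u} where
  obj C := (sdBox k).op ⋙ yoneda.obj C
  map φ := Functor.whiskerLeft _ (yoneda.map φ)

/-- The directed singular cubical set functor: the `n`-cubes of `sing X` are the stream maps
`𝕀ⁿ → X`. -/
noncomputable def sing : DiTop.{u} ⥤ CubicalSet.{u} where
  obj X :=
    { obj := fun n => StreamMap (dicube n.unop.dim) X.obj
      map := fun f => ↾fun σ => σ.comp (realize f.unop.2)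
      map_id := fun n => by
        refine ConcreteCategory.hom_ext _ _ fun σ => ?_
        exact congrArg (StreamMap.comp σ) (realize_id n.unop.dim)
      map_comp := fun f g => by
        refine ConcreteCategory.hom_ext _ _ fun σ => ?_
        exact congrArg (StreamMap.comp σ) (realize_comp f.unop.2 g.unop.2) }
  map g := { app := fun n => ↾fun σ => StreamMap.comp g.hom σ }

/-! ### The functor `(-)^♯` -/

/-- The relation defining the coend below. -/
inductive SharpRel (C : CubicalSet.{u}) (n : ℕ) :
    (Σ m : Box, C.obj (.op m) × StreamMap (dicube n) (dicube m.dim)) →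
    (Σ m : Box, C.obj (.op m) × StreamMap (dicube n) (dicube m.dim)) → Prop
  | mk {l m : Box} (φ : l ⟶ m) (c : C.obj (.op m)) (f : StreamMap (dicube n) (dicube l.dim)) :
      SharpRel C n ⟨l, C.map φ.op c, f⟩ ⟨m, c, (realize φ.2).comp f⟩

/-- The `n`-cubes of `C^♯`, where `(-)^♯` is the left Kan extension along the Yoneda embedding of
the functor sending `[1]ᵐ` to the directed singular cubical set of `𝕀ᵐ`: by the coend formula, they
are the classes of pairs of an `m`-cube `c` of `C` and a stream map `f : 𝕀ⁿ → 𝕀ᵐ`, where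
`(C(φ) c, f)` is identified with `(c, |φ| ∘ f)`. -/
def SharpCube (C : CubicalSet.{u}) (n : ℕ) : Type u :=
  Quot (SharpRel C n)

/-- The class of a pair `(c, f)`. -/
def SharpCube.mk {C : CubicalSet.{u}} {n : ℕ} {m : Box} (c : C.obj (.op m))
    (f : StreamMap (dicube n) (dicube m.dim)) : SharpCube C n :=
  Quot.mk _ ⟨m, c, f⟩

theorem SharpCube.sound {C : CubicalSet.{u}} {n : ℕ} {l m : Box} (φ : l ⟶ m)
    (c : C.obj (.op m)) (f : StreamMap (dicube n) (dicube l.dim)) :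
    SharpCube.mk (C.map φ.op c) f = SharpCube.mk c ((realize φ.2).comp f) :=
  Quot.sound (SharpRel.mk φ c f)

/-- Functions out of `SharpCube C n`. -/
def SharpCube.lift {C : CubicalSet.{u}} {n : ℕ} {T : Type v}
    (F : ∀ {m : Box}, C.obj (.op m) → StreamMap (dicube n) (dicube m.dim) → T)
    (hF : ∀ {l m : Box} (φ : l ⟶ m) (c : C.obj (.op m)) (f : StreamMap (dicube n) (dicube l.dim)),
      F (C.map φ.op c) f = F c ((realize φ.2).comp f)) : SharpCube C n → T :=
  Quot.lift (fun p => F p.2.1 p.2.2) (by rintro _ _ ⟨φ, c, f⟩; exact hF φ c f)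

@[simp] theorem SharpCube.lift_mk {C : CubicalSet.{u}} {n : ℕ} {T : Type v}
    (F : ∀ {m : Box}, C.obj (.op m) → StreamMap (dicube n) (dicube m.dim) → T)
    (hF : ∀ {l m : Box} (φ : l ⟶ m) (c : C.obj (.op m)) (f : StreamMap (dicube n) (dicube l.dim)),
      F (C.map φ.op c) f = F c ((realize φ.2).comp f)) {m : Box} (c : C.obj (.op m))
    (f : StreamMap (dicube n) (dicube m.dim)) : SharpCube.lift F hF (SharpCube.mk c f) = F c f :=
  rfl

theorem SharpCube.ind {C : CubicalSet.{u}} {n : ℕ} {P : SharpCube C n → Prop}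
    (h : ∀ {m : Box} (c : C.obj (.op m)) (f : StreamMap (dicube n) (dicube m.dim)),
      P (SharpCube.mk c f)) (z : SharpCube C n) : P z :=
  Quot.ind (fun p => h p.2.1 p.2.2) z

/-- Precomposition of a cube of `C^♯` with a stream map between directed cubes. -/
def SharpCube.precomp {C : CubicalSet.{u}} {n n' : ℕ} (g : StreamMap (dicube n') (dicube n)) :
    SharpCube C n → SharpCube C n' :=
  SharpCube.lift (fun c f => SharpCube.mk c (f.comp g)) fun φ c f => SharpCube.sound φ c (f.comp g)

/-- The functor `(-)^♯`. -/
noncomputable def sharp : CubicalSet.{u} ⥤ CubicalSet.{u} where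
  obj C :=
    { obj := fun n => SharpCube C n.unop.dim
      map := fun φ => ↾SharpCube.precomp (realize φ.unop.2)
      map_id := fun n => by
        ext z
        induction z using SharpCube.ind with
        | h c f => exact congrArg (fun g => SharpCube.mk c (f.comp g)) (realize_id n.unop.dim)
      map_comp := fun φ ψ => by
        ext z
        induction z using SharpCube.ind with
        | h c f =>
          exact congrArg (fun g => SharpCube.mk c (f.comp g)) (realize_comp φ.unop.2 ψ.unop.2) }
  map {C D} θ :=
    { app := fun n => ↾SharpCube.lift (fun {m} c f => SharpCube.mk (θ.app (.op m) c) f)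
        (fun φ c f => by
          rw [← SharpCube.sound φ]
          exact congrArg (fun d => SharpCube.mk d f) (NatTrans.naturality_apply θ φ.op c))
      naturality := fun n n' φ => by
        ext z
        induction z using SharpCube.ind with
        | h c f => rfl }
  map_id C := by
    ext n z
    induction z using SharpCube.ind with
    | h c f => rfl
  map_comp θ θ' := by
    ext n z
    induction z using SharpCube.ind with
    | h c f => rfl

/-- The unit `C → C^♯`, which extends the unit `□[1]ᵐ → sing 𝕀ᵐ` on representables. -/
noncomputable def sharpUnit : 𝟭 CubicalSet.{u} ⟶ sharp where
  app C :=
    { app := fun n => ↾fun c => SharpCube.mk (m := n.unop) c (StreamMap.id _)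
      naturality := fun n n' φ => by
        ext c
        exact SharpCube.sound φ.unop c (StreamMap.id _) }

/-- The natural cubical function `C^♯ → ex_{k+1} (C^♯)`. For `C = □[1]ᵐ` it sends a stream map
`f : 𝕀ⁿ → 𝕀ᵐ`, a cube of `sing 𝕀ᵐ`, to its composite with the homeomorphism from the directed
realization of the `(k+1)`-fold subdivision of the `n`-cube to `𝕀ⁿ`, given as the cubical function
`□[sd_{k+1} [1]ⁿ] → sing 𝕀ᵐ` with values `f ∘ sdCell γ`. -/
noncomputable def sharpSd (k : ℕ) : sharp.{u} ⟶ sharp ⋙ ex k where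
  app C :=
    { app := fun n => ↾fun z =>
        { app := fun j => ↾fun γ => SharpCube.precomp (sdCell k γ.down.2) z
          naturality := fun j j' φ => by
            ext γ
            induction z using SharpCube.ind with
            | h c f =>
              exact congrArg (fun g => SharpCube.mk c (f.comp g))
                (sdCell_comp k γ.down.2 φ.unop.2) }
      naturality := fun n n' φ => by
        ext z
        refine NatTrans.ext (funext fun j => ?_)
        ext γ
        induction z using SharpCube.ind with
        | h c f =>
          exact congrArg (fun g => SharpCube.mk c (f.comp g))
            (realize_comp_sdCell k φ.unop.2 γ.down.2) }
  naturality C D θ := by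
    ext n z
    refine NatTrans.ext (funext fun j => ?_)
    ext γ
    induction z using SharpCube.ind with
    | h c f => rfl

/-! ### Cubcats -/

/-- A `G`-cubical set, that is, a functor `C` from `G` to cubical sets, is a `G`-cubcat if there are
natural transformations `ρ : C^♯ → C` and `μ : ex_2 C → C` such that `ρ` is a retraction of the unit
`C → C^♯` and `μ ∘ ex_2 ρ ∘ sharpSd = ρ`. -/
def IsCubcat {G : Type v} [Category.{w} G] (C : G ⥤ CubicalSet.{u}) : Prop :=
  ∃ (ρ : C ⋙ sharp ⟶ C) (μ : C ⋙ ex 1 ⟶ C),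
    Functor.whiskerLeft C sharpUnit ≫ ρ = 𝟙 C ∧
    Functor.whiskerLeft C (sharpSd 1) ≫ Functor.whiskerRight ρ (ex 1) ≫ μ = ρ

end DirectedCubes

namespace DirectedCubes

/-! ### Maximal cells of the twofold subdivision of a cube -/

/-! The retraction `ρ` is composition: the class of a cube `c` of `sing X` and a stream map `f` goes
to `c ∘ f`. It respects the coend relation because composition is associative, and it retracts the
unit because `c ∘ id = c`.

The function `μ` glues. The twofold subdivision cuts `𝕀ⁿ` into `2ⁿ` half-size subcubes, one for each
vertex `a` of `[1]ⁿ`, and `sdTopCell a` is the corresponding top-dimensional cell. A cubical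
function `σ : sd_2 □[1]ⁿ → sing X` gives a stream map on each subcube. Two subcubes that share a
facet induce the same cell on it, so naturality of `σ` makes the stream maps agree there
(`isHalfCompatible_exCell`). Facets suffice: any subcube containing a point is joined to the least
such one by crossing facets through that point (`halfGlueFun_eq`).

The glued map is continuous because the subcubes form a finite closed cover. It is a stream map
because every order interval of the cube is crossed in two steps, each within one subcube
(`exists_midpoint_halfCubeSet`), while inside a subcube the directedness of the given piece applies
(`StreamMap.halfGlue`).

A stream map on `𝕀ⁿ` is determined by its restrictions to the subcubes (`StreamMap.ext_sdTopCell`),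
which reduces all identities for `μ` to single cells. Naturality in the cube category then rests on
the fact that a box map `f` carries the cell at `a` into the cell at `f a` (`sdMap_comp_sdTopCell`).
In the second cubcat equation, cutting `c ∘ f` into pieces and gluing them again returns `c ∘ f`.
Both `ρ` and `μ` are natural in the stream `X`, so whiskering with a functor out of `G` gives the
equivariant statement. -/

/-- The maximal cell of `sd_2 [1]ⁿ` with minimal vertex `a`: it sends `v` to the pair
`(a ⊓ v, a ⊔ v)`, identified with `a + v`. -/
def sdTopCell {n : ℕ} (a : BoolCube n) : BoolCube n → SdCube 1 n := fun v =>
  ⟨fun t => if t = 0 then a ⊓ v else a ⊔ v, fun s t h => by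
    dsimp only
    split_ifs with hs ht ht
    · exact le_rfl
    · exact inf_le_left.trans le_sup_left
    · subst ht; exact absurd (le_antisymm h (Fin.zero_le s)) hs
    · exact le_rfl⟩

theorem sdTopCell_zero {n : ℕ} (a v : BoolCube n) : sdTopCell a v 0 = a ⊓ v := rfl

theorem sdTopCell_one {n : ℕ} (a v : BoolCube n) : sdTopCell a v 1 = a ⊔ v := rfl

theorem SdCube.ext_two {n : ℕ} {ζ ξ : SdCube 1 n} (h0 : ζ 0 = ξ 0) (h1 : ζ 1 = ξ 1) : ζ = ξ := by
  refine OrderHom.ext _ _ (funext fun t => ?_)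
  fin_cases t
  · exact h0
  · exact h1

/-- Distributivity makes `a ⊓ ·` and `a ⊔ ·` lattice homomorphisms, and lifting points of intervals
is a coordinatewise check, so `isDisMap_of_lift` applies. -/
theorem isDisMap_sdTopCell {n : ℕ} (a : BoolCube n) : IsDisMap (sdTopCell a) := by
  have : Finite (SdCube 1 n) := DFunLike.finite _
  refine isDisMap_of_lift (fun x y z t => le_of_eq (inf_sup_left (x t) (y t) (z t)))
    (fun x y => SdCube.ext_two (inf_sup_left a x y) (sup_sup_distrib_left a x y))
    (fun x y => SdCube.ext_two (inf_inf_distrib_left a x y) (sup_inf_left a x y))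
    fun b c hbc z h1 h2 =>
      -- In coordinate `i` the cell takes the value `(0, v i)` if `a i = 0` and `(v i, 1)` if `a i =
      -- 1`. The witness reads off the free entry; the bounds on `z` force the other one.
      ⟨fun i => if a i = 0 then z 1 i else z 0 i, fun i => ?_, fun i => ?_, ?_⟩
  · have h3 : a i ⊓ b i ≤ z 0 i := h1 0 i
    have h4 : a i ⊔ b i ≤ z 1 i := h1 1 i
    grind
  · have h3 : z 0 i ≤ a i ⊓ c i := h2 0 i
    have h4 : z 1 i ≤ a i ⊔ c i := h2 1 i
    grind
  · have h3 : ∀ i, a i ⊓ b i ≤ z 0 i := h1 0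
    have h4 : ∀ i, a i ⊔ b i ≤ z 1 i := h1 1
    have h5 : ∀ i, z 0 i ≤ a i ⊓ c i := h2 0
    have h6 : ∀ i, z 1 i ≤ a i ⊔ c i := h2 1
    refine SdCube.ext_two (funext fun i => ?_) (funext fun i => ?_)
    · change a i ⊓ (if a i = 0 then z 1 i else z 0 i) = z 0 i
      have := h3 i; have := h4 i; have := h5 i; have := h6 i
      grind
    · change a i ⊔ (if a i = 0 then z 1 i else z 0 i) = z 1 i
      have := h3 i; have := h4 i; have := h5 i; have := h6 i
      grind

/-- Holds because box maps preserve meets and joins. It is the combinatorial source of the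
naturality of gluing. -/
theorem sdMap_comp_sdTopCell {m n : ℕ} {f : BoolCube m → BoolCube n} (hf : IsBoxMap f)
    (a : BoolCube m) : sdMap 1 hf ∘ sdTopCell a = sdTopCell (f a) ∘ f :=
  funext fun v => SdCube.ext_two (hf.map_inf a v) (hf.map_sup a v)

/-- The upper face of a maximal cell is the lower face of the adjacent one. -/
theorem sdTopCell_comp_coface {n : ℕ} (a : BoolCube (n + 1)) (i : Fin (n + 1)) (ha : a i = 0) :
    sdTopCell a ∘ (fun v : BoolCube n => (i.insertNth 1 v : BoolCube (n + 1))) =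
      sdTopCell (Function.update a i 1) ∘ (fun v => (i.insertNth 0 v : BoolCube (n + 1))) := by
  refine funext fun v => SdCube.ext_two (funext fun j => ?_) (funext fun j => ?_) <;>
  · simp only [Function.comp_apply, sdTopCell_zero, sdTopCell_one, Pi.inf_apply, Pi.sup_apply]
    refine Fin.succAboveCases i ?_ (fun j => ?_) j
    -- In coordinate `i` both sides are the pair `(0, 1)`, the midpoint of the subdivided edge.
    · simp [ha]
    · simp

/-! ### Affine charts of the half-size subcubes -/

/-- The affine map of `𝕀ⁿ` onto the subcube with minimal vertex `a / 2`. -/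
noncomputable def halfCube {n : ℕ} (a : BoolCube n) : ICube n → ICube n :=
  sdCell 1 (isDisMap_sdTopCell a)

/-- Since `min + max` is the sum, the vertex `v` of the cell lies at `(a + v) / 2`. Its `i`-th
coordinate depends on `v i` alone, so multilinear interpolation reduces to affine interpolation in
`x i`. -/
theorem halfCube_coe {n : ℕ} (a : BoolCube n) (x : ICube n) (i : Fin n) :
    (halfCube a x i : ℝ) = (((a i : ℕ) : ℝ) + x i) / 2 := by
  have h : ∀ v, ((sdVertex 1 ∘ sdTopCell a) v i : ℝ) =
      (fun c : Fin 2 => (((a i : ℕ) : ℝ) + ((c : ℕ) : ℝ)) / 2) (v i) := by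
    intro v
    change (∑ t : Fin 2, ((sdTopCell a v t i : ℕ) : ℝ)) / (((1 : ℕ) : ℝ) + 1) = _
    rw [Fin.sum_univ_two, sdTopCell_zero, sdTopCell_one, Pi.inf_apply, Pi.sup_apply, Nat.cast_one,
      one_add_one_eq_two]
    congr 1
    rcases le_total (a i) (v i) with h | h
    · rw [inf_eq_left.2 h, sup_eq_right.2 h]
    · rw [inf_eq_right.2 h, sup_eq_left.2 h, add_comm]
  refine (cellMap_apply _ _ x i).trans ?_
  simp only [h]
  rw [interp_coord i (fun c : Fin 2 => (((a i : ℕ) : ℝ) + ((c : ℕ) : ℝ)) / 2)]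
  simp
  ring

theorem halfCube_mono {n : ℕ} (a : BoolCube n) : Monotone (halfCube a) := by
  intro x y h i
  have : (x i : ℝ) ≤ y i := h i
  rw [← Subtype.coe_le_coe, halfCube_coe, halfCube_coe]
  linarith

/-- The rescaling `x ↦ 2 x - a` of the subcube with minimal vertex `a / 2`, clamped to `𝕀ⁿ`. -/
noncomputable def halfCubeInv {n : ℕ} (a : BoolCube n) (x : ICube n) : ICube n := fun i =>
  Set.projIcc 0 1 zero_le_one (2 * (x i : ℝ) - ((a i : ℕ) : ℝ))

theorem continuous_halfCubeInv {n : ℕ} (a : BoolCube n) : Continuous (halfCubeInv a) :=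
  continuous_pi fun i => continuous_projIcc.comp (by fun_prop)

theorem halfCubeInv_mono {n : ℕ} (a : BoolCube n) : Monotone (halfCubeInv a) := by
  intro x y h i
  have : (x i : ℝ) ≤ y i := h i
  exact Set.monotone_projIcc _ (by linarith)

theorem halfCubeInv_halfCube {n : ℕ} (a : BoolCube n) (x : ICube n) :
    halfCubeInv a (halfCube a x) = x := by
  funext i
  have : 2 * (halfCube a x i : ℝ) - ((a i : ℕ) : ℝ) = x i := by rw [halfCube_coe]; ring
  rw [halfCubeInv, this, Set.projIcc_val]

/-- The subcube of `𝕀ⁿ` with minimal vertex `a / 2` and maximal vertex `(a + 1) / 2`. -/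
def halfCubeSet {n : ℕ} (a : BoolCube n) : Set (ICube n) :=
  {x | ∀ i, ((a i : ℕ) : ℝ) / 2 ≤ x i ∧ (x i : ℝ) ≤ (((a i : ℕ) : ℝ) + 1) / 2}

theorem isClosed_halfCubeSet {n : ℕ} (a : BoolCube n) : IsClosed (halfCubeSet a) := by
  simp only [halfCubeSet, Set.ofPred_forall]
  refine isClosed_iInter fun i => ?_
  have h : Continuous fun x : ICube n => (x i : ℝ) := by fun_prop
  exact (isClosed_le continuous_const h).inter (isClosed_le h continuous_const)

theorem halfCube_mem {n : ℕ} (a : BoolCube n) (x : ICube n) : halfCube a x ∈ halfCubeSet a := by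
  intro i
  rw [halfCube_coe]
  have := (x i).2.1
  have := (x i).2.2
  constructor <;> linarith

theorem halfCubeInv_coe {n : ℕ} {a : BoolCube n} {x : ICube n} (hx : x ∈ halfCubeSet a)
    (i : Fin n) : (halfCubeInv a x i : ℝ) = 2 * x i - ((a i : ℕ) : ℝ) := by
  have := hx i
  rw [halfCubeInv, Set.projIcc_of_mem zero_le_one ⟨by linarith, by linarith⟩]

theorem halfCube_halfCubeInv {n : ℕ} {a : BoolCube n} {x : ICube n} (hx : x ∈ halfCubeSet a) :
    halfCube a (halfCubeInv a x) = x := by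
  funext i
  refine Subtype.ext ?_
  rw [halfCube_coe, halfCubeInv_coe hx]
  ring

/-- The least vertex `a` such that `x` lies in the subcube `halfCubeSet a`. -/
noncomputable def halfCode {n : ℕ} (x : ICube n) : BoolCube n := fun i =>
  if (x i : ℝ) ≤ 1 / 2 then 0 else 1

theorem mem_halfCubeSet_halfCode {n : ℕ} (x : ICube n) : x ∈ halfCubeSet (halfCode x) := by
  intro i
  have := (x i).2.1
  have := (x i).2.2
  unfold halfCode
  split_ifs with h
  · constructor <;> norm_num <;> linarith
  · constructor <;> norm_num <;> linarith

/-! ### Gluing stream maps along the twofold subdivision -/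

/-- Families of maps on the maximal cells of the subdivision that agree on common facets. -/
def IsHalfCompatible {n : ℕ} {T : Type u} (σ : BoolCube n → ICube n → T) : Prop :=
  ∀ (a : BoolCube n) (i : Fin n) (y : ICube n), a i = 0 → y i = 1 →
    σ a y = σ (Function.update a i 1) (Function.update y i 0)

/-- The map on `𝕀ⁿ` that restricts to a compatible family on the cells of the subdivision. -/
noncomputable def halfGlueFun {n : ℕ} {T : Type u} (σ : BoolCube n → ICube n → T)
    (x : ICube n) : T :=
  σ (halfCode x) (halfCubeInv (halfCode x) x)

/-- Well-founded induction on `a`. If `a` is not the least code of `x`, then some coordinate has `a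
i = 1` and `x i = 1 / 2`. Lowering `a i` to `0` gives a smaller subcube index `b` whose subcube
still contains `x`, and compatibility across the shared facet identifies the two values. -/
theorem halfGlueFun_eq {n : ℕ} {T : Type u} {σ : BoolCube n → ICube n → T}
    (hσ : IsHalfCompatible σ) {x : ICube n} (a : BoolCube n) (hx : x ∈ halfCubeSet a) :
    halfGlueFun σ x = σ a (halfCubeInv a x) := by
  induction a using WellFoundedLT.induction with
  | ind a ih =>
    by_cases ha : a = halfCode x
    · rw [ha]; rfl
    obtain ⟨i, hi⟩ := Function.ne_iff.1 ha
    have hxi := hx i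
    have hai : a i = 1 ∧ (x i : ℝ) = 1 / 2 := by
      unfold halfCode at hi
      split_ifs at hi with h
      · have h1 : a i = 1 := by omega
        rw [h1] at hxi
        norm_num at hxi
        exact ⟨h1, le_antisymm h (by linarith)⟩
      · have h0 : a i = 0 := by omega
        rw [h0] at hxi
        norm_num at hxi
        exact absurd hxi.2 (by linarith)
    set b : BoolCube n := Function.update a i 0 with hb
    have hba : a = Function.update b i 1 := by
      rw [hb, Function.update_idem, ← hai.1, Function.update_eq_self]
    have hxb : x ∈ halfCubeSet b := by
      intro j
      by_cases hj : j = i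
      · subst hj
        rw [hb, Function.update_self, hai.2]
        norm_num
      · rw [hb, Function.update_of_ne hj]
        exact hx j
    have hlt : b < a := by
      rw [hb, update_lt_self_iff, hai.1]
      exact Fin.zero_lt_one
    -- At `x i = 1 / 2` the local coordinate is `1` in the subcube of `b` and `0` in that of `a`;
    -- the other coordinates agree.
    have hinv : halfCubeInv a x = Function.update (halfCubeInv b x) i 0 := by
      funext j
      by_cases hj : j = i
      · subst hj
        refine Subtype.ext ?_
        rw [halfCubeInv_coe hx, hai.1, hai.2, Function.update_self]
        norm_num
      · rw [Function.update_of_ne hj, halfCubeInv, halfCubeInv, hb, Function.update_of_ne hj]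
    rw [ih b hlt hxb, hσ b i _ (by simp [hb]), ← hba, ← hinv]
    refine Subtype.ext ?_
    rw [halfCubeInv_coe hxb, hai.2, hb, Function.update_self]
    norm_num

theorem halfGlueFun_halfCube {n : ℕ} {T : Type u} {σ : BoolCube n → ICube n → T}
    (hσ : IsHalfCompatible σ) (a : BoolCube n) (x : ICube n) :
    halfGlueFun σ (halfCube a x) = σ a x := by
  rw [halfGlueFun_eq hσ a (halfCube_mem a x), halfCubeInv_halfCube]

/-- An order interval is crossed in two steps, each within one subcube. -/
theorem exists_midpoint_halfCubeSet {n : ℕ} {x y : ICube n} (h : x ≤ y) :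
    ∃ z a b, x ≤ z ∧ z ≤ y ∧ x ∈ halfCubeSet a ∧ z ∈ halfCubeSet a ∧ z ∈ halfCubeSet b ∧
      y ∈ halfCubeSet b := by
  have hmid : (1 / 2 : ℝ) ∈ Set.Icc (0 : ℝ) 1 := by norm_num
  have hz : ∀ i, ((x i ⊔ (y i ⊓ (⟨1 / 2, hmid⟩ : unitInterval)) : unitInterval) : ℝ) =
      max (x i : ℝ) (min (y i) (1 / 2)) := fun i => by
    have hmono : Monotone ((↑) : unitInterval → ℝ) := fun _ _ h => h
    exact (hmono.map_sup _ _).trans (congrArg (max _) (hmono.map_inf _ _))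
  -- The midpoint raises to at most `1 / 2` the coordinates of `x` that start below it and leaves
  -- the others fixed. The second step moves only coordinates already at `1 / 2` or above.
  refine ⟨fun i => x i ⊔ (y i ⊓ ⟨1 / 2, hmid⟩), fun i => if (x i : ℝ) < 1 / 2 then 0 else 1,
    halfCode y, fun i => le_sup_left, fun i => sup_le (h i) inf_le_left,
    fun i => ?_, fun i => ?_, fun i => ?_, mem_halfCubeSet_halfCode y⟩
  all_goals
    have h1 := (x i).2.1
    have h2 := (x i).2.2
    have h3 := (y i).2.1
    have h4 := (y i).2.2
    have h5 : (x i : ℝ) ≤ y i := h i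
  · dsimp only
    split_ifs <;> constructor <;> norm_num <;> linarith
  · rw [hz]
    dsimp only
    split_ifs with hx
    · norm_num
      exact ⟨Or.inl h1, hx.le⟩
    · norm_num
      exact ⟨Or.inl (by linarith), h2⟩
  · rw [hz]
    unfold halfCode
    split_ifs with hy
    · rw [min_eq_left hy, max_eq_right h5]
      norm_num
      exact ⟨h3, by linarith⟩
    · rw [min_eq_right (le_of_not_ge hy)]
      norm_num
      exact h2

/-- Compatible stream maps on the maximal cells glue to a stream map. -/
noncomputable def StreamMap.halfGlue {n : ℕ} {X : TopStream.{u}}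
    (σ : BoolCube n → StreamMap (dicube n) X) (hσ : IsHalfCompatible fun a x => σ a x) :
    StreamMap (dicube n) X where
  toFun := halfGlueFun fun a x => σ a x
  continuous_toFun := by
    refine (locallyFinite_of_finite halfCubeSet).continuous ?_ isClosed_halfCubeSet fun a => ?_
    · exact Set.eq_univ_of_forall fun x => Set.mem_iUnion.2 ⟨_, mem_halfCubeSet_halfCode x⟩
    · refine ContinuousOn.congr ?_ fun x hx => halfGlueFun_eq hσ a hx
      -- Clamping makes `halfCubeInv a` continuous on the whole cube, so no separate argument on the
      -- closed piece is needed.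
      exact ((σ a).continuous_toFun.comp (continuous_halfCubeInv a)).continuousOn
  map_le U x y := by
    have step : ∀ (a : BoolCube n) {p q : ICube n}, p ≤ q → p ∈ halfCubeSet a →
        q ∈ halfCubeSet a → (∀ z ∈ Set.Icc p q, halfGlueFun (fun a x => σ a x) z ∈ U) →
        X.circ.le U (halfGlueFun (fun a x => σ a x) p) (halfGlueFun (fun a x => σ a x) q) := by
      intro a p q hpq hp hq hU
      -- The chart sends the rescaled interval into `Set.Icc p q`, so the rescaled endpoints form a
      -- generating pair of the preorder on the preimage of `U` under `σ a`.
      have hsub : ∀ z ∈ Set.Icc (halfCubeInv a p) (halfCubeInv a q), σ a z ∈ U := by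
        intro z hz
        rw [← halfGlueFun_halfCube hσ a z]
        refine hU _ ⟨?_, ?_⟩
        · exact (halfCube_halfCubeInv hp).symm.le.trans (halfCube_mono a hz.1)
        · exact (halfCube_mono a hz.2).trans (halfCube_halfCubeInv hq).le
      rw [halfGlueFun_eq hσ a hp, halfGlueFun_eq hσ a hq]
      have hle := halfCubeInv_mono a hpq
      exact (σ a).map_le U _ _ ⟨hsub _ ⟨le_rfl, hle⟩, .single ⟨hle, hsub⟩⟩
    rintro ⟨hx, h⟩
    refine X.circ.of_gen (r := fun p q => X.circ.le U p q) (fun _ _ h => h) hx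
      (h.lift _ fun p q hpq => ?_)
    obtain ⟨hpq, hU⟩ := hpq
    obtain ⟨z, a, b, hpz, hzq, h1, h2, h3, h4⟩ := exists_midpoint_halfCubeSet hpq
    exact X.circ.trans (step a hpz h1 h2 fun w hw => hU ⟨hw.1, hw.2.trans hzq⟩)
      (step b hzq h3 h4 fun w hw => hU ⟨hpz.trans hw.1, hw.2⟩)

theorem StreamMap.halfGlue_comp {n : ℕ} {X : TopStream.{u}}
    (σ : BoolCube n → StreamMap (dicube n) X) (hσ : IsHalfCompatible fun a x => σ a x)
    (a : BoolCube n) : (halfGlue σ hσ).comp (sdCell 1 (isDisMap_sdTopCell a)) = σ a :=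
  StreamMap.hext fun x => halfGlueFun_halfCube hσ a x

/-- A stream map on a cube is determined by its restrictions to the maximal cells. -/
theorem StreamMap.ext_sdTopCell {n : ℕ} {X : TopStream.{u}} {f g : StreamMap (dicube n) X}
    (h : ∀ a, f.comp (sdCell 1 (isDisMap_sdTopCell a)) =
      g.comp (sdCell 1 (isDisMap_sdTopCell a))) : f = g := by
  refine StreamMap.hext fun x => ?_
  have h1 := congrArg (fun k => k (halfCubeInv (halfCode x) x)) (h (halfCode x))
  have h2 : halfCube (halfCode x) (halfCubeInv (halfCode x) x) = x :=
    halfCube_halfCubeInv (mem_halfCubeSet_halfCode x)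
  change f (halfCube _ _) = g (halfCube _ _) at h1
  rwa [h2] at h1

/-! ### The cubcat structure on directed singular cubical sets -/

/-- The target point `y` is described by its coordinates so that a point of a facet can be
recognized as a face image without computing the interpolation again. -/
theorem realize_coface_apply {n : ℕ} (i : Fin (n + 1)) (ε : Fin 2) (x : ICube n)
    (y : ICube (n + 1)) (h0 : (y i : ℝ) = ((ε : ℕ) : ℝ)) (h1 : ∀ j, y (i.succAbove j) = x j) :
    realize (IsBoxMap.coface i ε) x = y := by
  refine funext fun j => Subtype.ext ?_
  refine (cellMap_apply _ _ x j).trans ?_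
  simp only [Function.comp_apply, vertex_coe]
  refine Fin.succAboveCases i ?_ (fun j => ?_) j
  · simp [interp_const, h0]
  · simp only [Fin.insertNth_apply_succAbove]
    rw [interp_coord j (fun c => ((c : ℕ) : ℝ)), h1]
    simp

/-- The value on a cell of a cube of `ex_2 (sing X)`. -/
def exCell {X : DiTop.{u}} {n : Box} (σ : (sdBox.{u} 1).obj n ⟶ sing.obj X) {j : ℕ}
    {γ : BoolCube j → SdCube 1 n.dim} (hγ : IsDisMap γ) : StreamMap (dicube j) X.obj :=
  σ.app (.op ⟨j⟩) ⟨⟨γ, hγ⟩⟩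

theorem exCell_comp {X : DiTop.{u}} {n : Box} (σ : (sdBox.{u} 1).obj n ⟶ sing.obj X) {l j : ℕ}
    {γ : BoolCube j → SdCube 1 n.dim} (hγ : IsDisMap γ) {f : BoolCube l → BoolCube j}
    (hf : IsBoxMap f) :
    exCell σ (hγ.comp hf.isDisMap) = (exCell σ hγ).comp (realize hf) :=
  NatTrans.naturality_apply σ
    (Quiver.Hom.op (⟨f, hf⟩ : (⟨l⟩ : Box) ⟶ ⟨j⟩)) ⟨⟨γ, hγ⟩⟩

/-- Permits replacing a cell by an equal one although the proof `hγ` depends on it. -/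
theorem exCell_congr {X : DiTop.{u}} {n : Box} (σ : (sdBox.{u} 1).obj n ⟶ sing.obj X) {j : ℕ}
    {γ γ' : BoolCube j → SdCube 1 n.dim} (h : γ = γ') (hγ : IsDisMap γ) (hγ' : IsDisMap γ') :
    exCell σ hγ = exCell σ hγ' := by
  subst h; rfl

/-- By `sdTopCell_comp_coface` the facet shared by two adjacent maximal cells is a single cell of
the subdivision. By naturality, the value of `σ` there is the restriction of both neighbouring
values. -/
theorem isHalfCompatible_exCell {X : DiTop.{u}} {n : Box}
    (σ : (sdBox.{u} 1).obj n ⟶ sing.obj X) :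
    IsHalfCompatible fun a x => exCell σ (isDisMap_sdTopCell a) x := by
  -- Cofaces land in positive dimension; the point has no facets, so nothing is to be checked there.
  obtain ⟨_ | n⟩ := n
  · exact fun _ i => i.elim0
  intro a i y ha hy
  have h := exCell_congr σ (sdTopCell_comp_coface a i ha)
    ((isDisMap_sdTopCell _).comp (IsBoxMap.coface i 1).isDisMap)
    ((isDisMap_sdTopCell _).comp (IsBoxMap.coface i 0).isDisMap)
  rw [exCell_comp σ (isDisMap_sdTopCell a) (IsBoxMap.coface i 1),
    exCell_comp σ (isDisMap_sdTopCell _) (IsBoxMap.coface i 0)] at h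
  have h1 : realize (IsBoxMap.coface i 1) (i.removeNth y : ICube n) = y :=
    realize_coface_apply i 1 _ y (by simp [hy]) fun _ => rfl
  have h0 : realize (IsBoxMap.coface i 0) (i.removeNth y : ICube n) = Function.update y i 0 :=
    realize_coface_apply i 0 _ _ (by simp) fun j => by simp [Fin.removeNth]
  exact (congrArg (exCell σ (isDisMap_sdTopCell a)) h1.symm).trans
    ((congrArg (fun k => k (i.removeNth y : ICube n)) h).trans
      (congrArg (exCell σ (isDisMap_sdTopCell (Function.update a i 1))) h0))

/-- The stream map on a cube glued from a cube of `ex_2 (sing X)`. -/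
noncomputable def exGlue {X : DiTop.{u}} {n : Box} (σ : (sdBox.{u} 1).obj n ⟶ sing.obj X) :
    StreamMap (dicube n.dim) X.obj :=
  StreamMap.halfGlue (fun a => exCell σ (isDisMap_sdTopCell a)) (isHalfCompatible_exCell σ)

theorem exGlue_comp {X : DiTop.{u}} {n : Box} (σ : (sdBox.{u} 1).obj n ⟶ sing.obj X)
    (a : BoolCube n.dim) :
    (exGlue σ).comp (sdCell 1 (isDisMap_sdTopCell a)) = exCell σ (isDisMap_sdTopCell a) :=
  StreamMap.halfGlue_comp _ _ a

theorem sdCell_congr {k j n : ℕ} {γ γ' : BoolCube j → SdCube k n} (h : γ = γ') (hγ : IsDisMap γ)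
    (hγ' : IsDisMap γ') : sdCell k hγ = sdCell k hγ' := by
  subst h; rfl

/-- The realization of `f` carries the subcube at `a` into the subcube at `f a`, where the glued map
is known to be the value of `σ`. Naturality of `σ` along `f` then rewrites the result as its value
on the cell `sdMap 1 hf ∘ sdTopCell a`. -/
theorem exGlue_comp_realize_comp {X : DiTop.{u}} {m n : Box}
    (σ : (sdBox.{u} 1).obj n ⟶ sing.obj X) {f : BoolCube m.dim → BoolCube n.dim} (hf : IsBoxMap f)
    (a : BoolCube m.dim) :
    ((exGlue σ).comp (realize hf)).comp (sdCell 1 (isDisMap_sdTopCell a)) =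
      exCell σ ((isDisMap_sdMap 1 hf).comp (isDisMap_sdTopCell a)) := by
  change (exGlue σ).comp ((realize hf).comp (sdCell 1 (isDisMap_sdTopCell a))) = _
  have h := sdMap_comp_sdTopCell hf a
  have hd := (isDisMap_sdTopCell (f a)).comp hf.isDisMap
  rw [realize_comp_sdCell, sdCell_congr h _ hd, exCell_congr σ h _ hd,
    sdCell_comp 1 (isDisMap_sdTopCell (f a)) hf, exCell_comp σ (isDisMap_sdTopCell (f a)) hf,
    ← exGlue_comp]
  rfl

/-! ### The structure maps and the cubcat equations -/

/-- The natural cubical function `ex_2 (sing X) → sing X` gluing cells. -/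
noncomputable def singExGlue : sing.{u} ⋙ ex 1 ⟶ sing where
  app X :=
    { app := fun n => ↾fun σ => exGlue (n := n.unop) σ
      naturality := fun n n' φ => by
        ext σ
        refine StreamMap.ext_sdTopCell fun a => ?_
        refine (exGlue_comp _ a).trans (exGlue_comp_realize_comp σ φ.unop.2 a).symm }
  naturality X Y g := by
    ext n σ
    refine StreamMap.ext_sdTopCell fun a => ?_
    exact (exGlue_comp _ a).trans
      (congrArg (StreamMap.comp g.hom) (exGlue_comp (n := n.unop) σ a)).symm

/-- The natural retraction `(sing X)^♯ → sing X` composing cubes. -/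
noncomputable def singSharpRetraction : sing.{u} ⋙ sharp ⟶ sing where
  app X :=
    -- The coend relation is respected because `(c ∘ |φ|) ∘ f` and `c ∘ (|φ| ∘ f)` coincide
    -- definitionally.
    { app := fun n => ↾SharpCube.lift (fun c f => StreamMap.comp c f) fun φ c f => rfl
      naturality := fun n n' φ => by
        ext z
        induction z using SharpCube.ind with
        | h c f => rfl }
  naturality X Y g := by
    ext n z
    induction z using SharpCube.ind with
    | h c f => rfl

end DirectedCubes

theorem mainTheorem8 {G : Type v} [Category.{w} G] (X : G ⥤ DirectedCubes.DiTop.{u}) :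
    DirectedCubes.IsCubcat (X ⋙ DirectedCubes.sing) := by
  refine ⟨Functor.whiskerLeft X DirectedCubes.singSharpRetraction,
    Functor.whiskerLeft X DirectedCubes.singExGlue, ?_, ?_⟩
  · ext g n c
    rfl
  · ext g n z
    induction z using DirectedCubes.SharpCube.ind with
    | h c f =>
      -- On the subcube at `a`, the left side restricts to the piece it was glued from, which is by
      -- definition the restriction of `c ∘ f`.
      refine DirectedCubes.StreamMap.ext_sdTopCell fun a => ?_
      exact DirectedCubes.exGlue_comp _ a
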